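/- Let $W_1=\lambda_1u_1u_1^+$ be a complex $m\times m$ matrix of rank one, with $\lambda_1>0$ and $u_1$ a unit vector ($^+$ is conjugate transposition), let $W_2$ be a complex positive semi-definite $m\times m$ matrix, and let $P_T>0$, $P_I\ge 0$. For Hermitian $R\ge 0$ put $C(R)=\log|I+W_1R|$, and let $C=\max C(R)$ over all $R\ge 0$ that satisfy the total power constraint (TPC) $\mathrm{tr}\,R\le P_T$ and the interference power constraint (IPC) $\mathrm{tr}(W_2R)\le P_I$. A feasible $R$ attaining the maximum is called optimal. A constraint is redundant if omitting it does not change the maximum, and it is active if it holds with equality for every optimal $R$. Let $W_2^\dagger$ be the Moore–Penrose pseudo-inverse of $W_2$, $\mathcal N(\cdot)$ the null space, and $$\gamma_I=\frac{P_I}{P_T},\qquad \gamma_1=\frac{u_1^+W_2^\dagger u_1}{u_1^+(W_2^\dagger)^2u_1},\qquad \gamma_2=u_1^+W_2u_1 .$$ 1. Let $\mathcal N(W_2)\subseteq\mathcal N(W_1)$ and $\gamma_I\le\gamma_1$. Then the TPC is redundant, the matrix $$R^*=P_I\,\frac{W_2^\dagger u_1u_1^+W_2^\dagger}{u_1^+W_2^\dagger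 u_1}$$ is optimal (and is the only optimal matrix if $W_2$ is non-singular), and $C=\log(1+\lambda_1\alpha P_T)$ with $\alpha=\gamma_I\,u_1^+W_2^\dagger u_1$. If $\gamma_I<\gamma_1$, then $\alpha<1$; if $\gamma_I=\gamma_1$, then $\alpha\le 1$, with equality if and only if $u_1$ is an eigenvector of $W_2$. 2. If $\gamma_I\ge\gamma_2$, then the IPC is redundant, $R^*=P_Tu_1u_1^+$ (the standard water-filling solution, which is optimal under the TPC alone) is the unique optimal matrix, and $C=\log(1+\lambda_1P_T)$. Conversely, if $P_Tu_1u_1^+$ is optimal under the TPC and the IPC, then $\gamma_I\ge\gamma_2$. 3. Let $0<\gamma_I<\gamma_2$. If $\gamma_1\le\gamma_I$ or $\mathcal N(W_2)\not\subseteq\mathcal N(W_1)$, then both constraints are active. If $\gamma_1<\gamma_I$ or $\mathcal N(W_2)\not\subseteq\mathcal N(W_1)$, then, with $W_{2\mu}=I+\mu_2W_2$ and $$R^*=P_T\,\frac{W_{2\mu}^{-1}u_1u_1^+W_{2\mu}^{-1}}{u_1^+W_{2\mu}^{-2}u_1},$$ there is exactly one $\mu_2>0$ for which $\mathrm{tr}(W_2R^*)=P_I$;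 for this $\mu_2$ the matrix $R^*$ is the unique optimal matrix, and $C=\log(1+\lambda_1\alpha P_T)$ with $$\alpha=(u_1^+W_{2\mu}^{-1}u_1)^2\,|W_{2\mu}^{-1}u_1|^{-2}\le 1,$$ with equality if and only if $u_1$ is an eigenvector of $W_2$. -/

import Mathlib

namespace MIMO

open Matrix
open scoped ComplexOrder

/-- The four Penrose equations: `X` is a Moore-Penrose pseudo-inverse of `A`. -/
structure IsMoorePenrose {m n : ℕ} (A : Matrix (Fin m) (Fin n) ℂ)
    (X : Matrix (Fin n) (Fin m) ℂ) : Prop where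
  mul_mul_self : A * X * A = A
  self_mul_mul : X * A * X = X
  left_hermitian : (A * X).IsHermitian
  right_hermitian : (X * A).IsHermitian

theorem exists_isMoorePenrose {m n : ℕ} (A : Matrix (Fin m) (Fin n) ℂ) :
    ∃ X, IsMoorePenrose A X := by
  classical
  have hB : (Aᴴ * A).IsHermitian := isHermitian_conjTranspose_mul_self A
  obtain ⟨P, hP, h1, h2, h3⟩ : ∃ P : Matrix (Fin n) (Fin n) ℂ, Pᴴ = P ∧
      (Aᴴ * A) * P * (Aᴴ * A) = Aᴴ * A ∧ P * (Aᴴ * A) * P = P ∧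
      P * (Aᴴ * A) = (Aᴴ * A) * P := by
    generalize Aᴴ * A = B at hB
    set U : Matrix (Fin n) (Fin n) ℂ := (hB.eigenvectorUnitary : Matrix (Fin n) (Fin n) ℂ)
    have hU : Uᴴ * U = 1 := Matrix.mem_unitaryGroup_iff'.1 hB.eigenvectorUnitary.2
    have hspec : B = U * diagonal (fun i => (hB.eigenvalues i : ℂ)) * Uᴴ := by
      have := hB.spectral_theorem
      rw [Unitary.conjStarAlgAut_apply] at this
      exact this
    set D : Matrix (Fin n) (Fin n) ℂ := diagonal (fun i => (hB.eigenvalues i : ℂ)) with hD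
    set E : Matrix (Fin n) (Fin n) ℂ := diagonal (fun i => ((hB.eigenvalues i : ℂ))⁻¹) with hE
    have key : ∀ X Y : Matrix (Fin n) (Fin n) ℂ,
        (U * X * Uᴴ) * (U * Y * Uᴴ) = U * (X * Y) * Uᴴ := by
      intro X Y
      calc (U * X * Uᴴ) * (U * Y * Uᴴ) = U * X * (Uᴴ * U) * Y * Uᴴ := by
            simp only [Matrix.mul_assoc]
        _ = _ := by rw [hU]; simp only [Matrix.mul_assoc, Matrix.one_mul]
    have hDE : D * E = E * D := by
      rw [hD, hE, diagonal_mul_diagonal, diagonal_mul_diagonal]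
      simp only [mul_comm]
    have hDED : D * E * D = D := by
      rw [hD, hE, diagonal_mul_diagonal, diagonal_mul_diagonal]
      congr 1; funext i; exact mul_inv_mul_cancel _
    have hEDE : E * D * E = E := by
      rw [hD, hE, diagonal_mul_diagonal, diagonal_mul_diagonal]
      congr 1; funext i
      simpa using mul_inv_mul_cancel ((hB.eigenvalues i : ℂ)⁻¹)
    have hEh : Eᴴ = E := by
      rw [hE, diagonal_conjTranspose]
      congr 1; funext i; simp
    refine ⟨U * E * Uᴴ, ?_, ?_, ?_, ?_⟩
    · simp only [conjTranspose_mul, conjTranspose_conjTranspose, hEh, Matrix.mul_assoc]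
    · rw [hspec, key, key, hDED]
    · rw [hspec, key, key, hEDE]
    · rw [hspec, key, key, hDE]
  refine ⟨P * Aᴴ, ?_, ?_, ?_, ?_⟩
  · rw [← sub_eq_zero, ← conjTranspose_mul_self_eq_zero]
    have e1 : (A * (P * Aᴴ) * A - A)ᴴ = (Aᴴ * A) * P * Aᴴ - Aᴴ := by
      simp only [conjTranspose_sub, conjTranspose_mul, conjTranspose_conjTranspose, hP,
        Matrix.mul_assoc]
    have e2 : ((Aᴴ * A) * P * Aᴴ - Aᴴ) * A = 0 := by
      rw [Matrix.sub_mul, Matrix.mul_assoc _ Aᴴ A, h1, sub_self]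
    have e3 : A * (P * Aᴴ) * A - A = A * (P * (Aᴴ * A) - 1) := by
      simp only [Matrix.mul_sub, Matrix.mul_one, Matrix.mul_assoc]
    rw [e1, e3, ← Matrix.mul_assoc, e2, Matrix.zero_mul]
  · calc P * Aᴴ * A * (P * Aᴴ) = (P * (Aᴴ * A) * P) * Aᴴ := by simp only [Matrix.mul_assoc]
      _ = P * Aᴴ := by rw [h2]
  · simp only [IsHermitian, conjTranspose_mul, conjTranspose_conjTranspose, hP, Matrix.mul_assoc]
  · have : P * Aᴴ * A = P * (Aᴴ * A) := by simp only [Matrix.mul_assoc]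
    rw [this, IsHermitian, conjTranspose_mul, hP, hB.eq, h3]

/-- The Moore-Penrose pseudo-inverse `A†`. -/
noncomputable def pinv {m n : ℕ} (A : Matrix (Fin m) (Fin n) ℂ) : Matrix (Fin n) (Fin m) ℂ :=
  (exists_isMoorePenrose A).choose

theorem pinv_isMoorePenrose {m n : ℕ} (A : Matrix (Fin m) (Fin n) ℂ) :
    IsMoorePenrose A (pinv A) :=
  (exists_isMoorePenrose A).choose_spec

theorem IsMoorePenrose.unique {m n : ℕ} {A : Matrix (Fin m) (Fin n) ℂ}
    {X Y : Matrix (Fin n) (Fin m) ℂ} (hX : IsMoorePenrose A X) (hY : IsMoorePenrose A Y) :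
    X = Y := by
  have hAX : A * X = A * Y := by
    have h : A * X = (A * Y) * (A * X) := by
      rw [← Matrix.mul_assoc, hY.mul_mul_self]
    have h' := congrArg conjTranspose h
    rw [conjTranspose_mul (A * Y), hX.left_hermitian.eq, hY.left_hermitian.eq, ← Matrix.mul_assoc,
      hX.mul_mul_self] at h'
    exact h'
  have hXA : X * A = Y * A := by
    have h : X * A = (X * A) * (Y * A) := by
      rw [Matrix.mul_assoc, ← Matrix.mul_assoc A Y A, hY.mul_mul_self]
    have h' := congrArg conjTranspose h
    rw [conjTranspose_mul (X * A), hX.right_hermitian.eq, hY.right_hermitian.eq, Matrix.mul_assoc,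
      ← Matrix.mul_assoc A X A, hX.mul_mul_self] at h'
    exact h'
  calc X = X * A * X := hX.self_mul_mul.symm
    _ = Y * A * Y := by rw [hXA, Matrix.mul_assoc, hAX, ← Matrix.mul_assoc]
    _ = Y := hY.self_mul_mul

/-- The rank-one matrix `u u⁺`. -/
def outer {m : ℕ} (u : Fin m → ℂ) : Matrix (Fin m) (Fin m) ℂ :=
  vecMulVec u (star u)

/-- The quadratic form `u⁺ A u` (used for Hermitian `A` only, where it is real). -/
def quad {m : ℕ} (A : Matrix (Fin m) (Fin m) ℂ) (u : Fin m → ℂ) : ℝ :=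
  (star u ⬝ᵥ (A *ᵥ u)).re

/-- `C(R) = log |I + W₁ R|` (natural logarithm; the determinant is real, and at least 1,
for positive semi-definite `W₁` and `R`). -/
noncomputable def rate {m : ℕ} (W₁ R : Matrix (Fin m) (Fin m) ℂ) : ℝ :=
  Real.log (1 + W₁ * R).det.re

/-- Covariance matrices allowed by the total power constraint (TPC) `tr R ≤ P_T` alone. -/
def tpcSet {m : ℕ} (PT : ℝ) : Set (Matrix (Fin m) (Fin m) ℂ) :=
  {R | R.PosSemidef ∧ R.trace.re ≤ PT}

/-- Covariance matrices allowed by the interference power constraint (IPC)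
`tr (W₂ R) ≤ P_I` alone. -/
def ipcSet {m : ℕ} (W₂ : Matrix (Fin m) (Fin m) ℂ) (PI : ℝ) : Set (Matrix (Fin m) (Fin m) ℂ) :=
  {R | R.PosSemidef ∧ (W₂ * R).trace.re ≤ PI}

/-- Covariance matrices allowed by the TPC and the IPC jointly. -/
def jointSet {m : ℕ} (W₂ : Matrix (Fin m) (Fin m) ℂ) (PT PI : ℝ) :
    Set (Matrix (Fin m) (Fin m) ℂ) :=
  {R | R.PosSemidef ∧ R.trace.re ≤ PT ∧ (W₂ * R).trace.re ≤ PI}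

/-- `R` maximizes `C(R)` over the constraint set `S`. -/
def IsOptimal {m : ℕ} (W₁ : Matrix (Fin m) (Fin m) ℂ) (S : Set (Matrix (Fin m) (Fin m) ℂ))
    (R : Matrix (Fin m) (Fin m) ℂ) : Prop :=
  R ∈ S ∧ ∀ R' ∈ S, rate W₁ R' ≤ rate W₁ R

/-- `C = max_{R ∈ S} C(R)`, the maximum being attained. -/
def IsCapacity {m : ℕ} (W₁ : Matrix (Fin m) (Fin m) ℂ) (S : Set (Matrix (Fin m) (Fin m) ℂ))
    (C : ℝ) : Prop :=
  IsGreatest (rate W₁ '' S) C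

/-- The TPC can be omitted without affecting the capacity. -/
def TPCRedundant {m : ℕ} (W₁ W₂ : Matrix (Fin m) (Fin m) ℂ) (PT PI : ℝ) : Prop :=
  ∃ C : ℝ, IsCapacity W₁ (jointSet W₂ PT PI) C ∧ IsCapacity W₁ (ipcSet W₂ PI) C

/-- The IPC can be omitted without affecting the capacity. -/
def IPCRedundant {m : ℕ} (W₁ W₂ : Matrix (Fin m) (Fin m) ℂ) (PT PI : ℝ) : Prop :=
  ∃ C : ℝ, IsCapacity W₁ (jointSet W₂ PT PI) C ∧ IsCapacity W₁ (tpcSet PT) C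

/-- `γ₁ = u⁺ W₂† u / u⁺ (W₂†)² u`. -/
noncomputable def gamma₁ {m : ℕ} (W₂ : Matrix (Fin m) (Fin m) ℂ) (u : Fin m → ℂ) : ℝ :=
  quad (pinv W₂) u / quad (pinv W₂ ^ 2) u

/-- `γ₂ = u⁺ W₂ u`. -/
def gamma₂ {m : ℕ} (W₂ : Matrix (Fin m) (Fin m) ℂ) (u : Fin m → ℂ) : ℝ :=
  quad W₂ u

/-- `P_I W₂† u u⁺ W₂† / (u⁺ W₂† u)`. -/
noncomputable def covIPC {m : ℕ} (W₂ : Matrix (Fin m) (Fin m) ℂ) (u : Fin m → ℂ) (PI : ℝ) :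
    Matrix (Fin m) (Fin m) ℂ :=
  (PI / quad (pinv W₂) u) • (pinv W₂ * outer u * pinv W₂)

/-- `W_{2μ} = I + μ₂ W₂`. -/
noncomputable def W2mu {m : ℕ} (W₂ : Matrix (Fin m) (Fin m) ℂ) (μ₂ : ℝ) : Matrix (Fin m) (Fin m) ℂ :=
  1 + μ₂ • W₂

/-- `P_T W_{2μ}⁻¹ u u⁺ W_{2μ}⁻¹ / (u⁺ W_{2μ}⁻² u)`. -/
noncomputable def covMu {m : ℕ} (W₂ : Matrix (Fin m) (Fin m) ℂ) (u : Fin m → ℂ) (PT μ₂ : ℝ) :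
    Matrix (Fin m) (Fin m) ℂ :=
  (PT / quad ((W2mu W₂ μ₂)⁻¹ ^ 2) u) • ((W2mu W₂ μ₂)⁻¹ * outer u * (W2mu W₂ μ₂)⁻¹)

/-- `(u⁺ W_{2μ}⁻¹ u)² |W_{2μ}⁻¹ u|⁻²`, with the Euclidean norm. -/
noncomputable def alphaMu {m : ℕ} (W₂ : Matrix (Fin m) (Fin m) ℂ) (u : Fin m → ℂ) (μ₂ : ℝ) : ℝ :=
  quad (W2mu W₂ μ₂)⁻¹ u ^ 2 * (‖WithLp.toLp 2 ((W2mu W₂ μ₂)⁻¹ *ᵥ u)‖ ^ 2)⁻¹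

/-- `u` is an eigenvector of `W`. -/
def IsEigenvector {m : ℕ} (W : Matrix (Fin m) (Fin m) ℂ) (u : Fin m → ℂ) : Prop :=
  ∃ ν : ℂ, Module.End.HasEigenvector (Matrix.toLin' W) ν u

end MIMO

open MIMO
open scoped ComplexOrder

namespace MIMO

open Matrix Filter Topology
open scoped ComplexOrder

variable {m : ℕ} {A W R X P : Matrix (Fin m) (Fin m) ℂ} {u v x : Fin m → ℂ} {lam PT PI μ : ℝ}

/-! Since $W_1$ has rank one, the determinant lemma gives $C(R)=\log(1+\lambda_1u^+Ru)$
(`rate_smul_outer`), so the problem is to maximize the linear functional $u^+Ru$. All three regimes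
rest on one dual bound: if $W\ge0$ and $Wv=u$, Cauchy–Schwarz gives $uu^+\le(v^+Wv)W$, hence
$u^+Ru\le(v^+Wv)\,\mathrm{tr}(WR)$ (`quad_le_mul_trace`). Take $W=W_2$, $v=W_2^\dagger u$ for the
IPC alone, $W=I$, $v=u$ for the TPC alone, and $W=I+\mu W_2$, $v=W^{-1}u$ for both. In each case a
multiple of $vv^+$ attains the bound. Equality forces $((v^+Wv)W-uu^+)R=0$, which determines $R$
when $W$ is non-singular (`eq_smul_outer_of_quad_eq`).

The multiplier comes from the intermediate value theorem applied to the Rayleigh quotient of $W_2$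
at $v_\mu=(I+\mu W_2)^{-1}u$. It equals $\gamma_2$ at $\mu=0$; as $\mu\to\infty$ it tends to
$\gamma_1$ if $u$ is in the range of $W_2$, and to $0$ otherwise (`exists_rayleigh_lt`). Two
multipliers would give the same optimal matrix, hence parallel $v_\mu$, which is possible only if
they coincide or $u$ is an eigenvector; the latter contradicts $\gamma_I<\gamma_2$.

The statements on $\alpha$ are Cauchy–Schwarz, with its equality case, for $u$ and $v$. -/

/-! ### Norms, quadratic forms and rank-one matrices -/

theorem exists_eq_conjTranspose_mul_self (hW : W.PosSemidef) :
    ∃ B : Matrix (Fin m) (Fin m) ℂ, W = Bᴴ * B := by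
  open scoped MatrixOrder Matrix.Norms.L2Operator in
  exact CStarAlgebra.nonneg_iff_eq_star_mul_self.mp hW.nonneg

theorem norm_toLp_sq (x : Fin m → ℂ) : ‖WithLp.toLp 2 x‖ ^ 2 = (star x ⬝ᵥ x).re := by
  rw [@norm_sq_eq_re_inner ℂ, EuclideanSpace.inner_toLp_toLp, dotProduct_comm]
  rfl

theorem ofReal_norm_toLp_sq (x : Fin m → ℂ) :
    ((‖WithLp.toLp 2 x‖ ^ 2 : ℝ) : ℂ) = star x ⬝ᵥ x := by
  have := inner_self_eq_norm_sq_to_K (𝕜 := ℂ) (WithLp.toLp 2 x)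
  rw [EuclideanSpace.inner_toLp_toLp, dotProduct_comm] at this
  rw [this]; push_cast; rfl

theorem star_mulVec_dotProduct (A : Matrix (Fin m) (Fin m) ℂ) (x y : Fin m → ℂ) :
    star (A *ᵥ x) ⬝ᵥ y = star x ⬝ᵥ (Aᴴ *ᵥ y) := by
  rw [star_mulVec, dotProduct_mulVec]

theorem star_dotProduct_mulVec_of_isHermitian (hA : A.IsHermitian) (x y : Fin m → ℂ) :
    star x ⬝ᵥ (A *ᵥ y) = star (A *ᵥ x) ⬝ᵥ y := by
  rw [star_mulVec_dotProduct, hA.eq]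

theorem ofReal_quad (hA : A.IsHermitian) (x : Fin m → ℂ) :
    (quad A x : ℂ) = star x ⬝ᵥ (A *ᵥ x) := by
  apply Complex.conj_eq_iff_re.mp
  change star (star x ⬝ᵥ (A *ᵥ x)) = _
  rw [← star_dotProduct, star_dotProduct_mulVec_of_isHermitian hA]

theorem quad_nonneg (hA : A.PosSemidef) (x : Fin m → ℂ) : 0 ≤ quad A x :=
  (Complex.nonneg_iff.mp (hA.dotProduct_mulVec_nonneg x)).1

theorem quad_conjTranspose_mul_self (B : Matrix (Fin m) (Fin m) ℂ) (x : Fin m → ℂ) :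
    quad (Bᴴ * B) x = ‖WithLp.toLp 2 (B *ᵥ x)‖ ^ 2 := by
  rw [norm_toLp_sq, star_mulVec_dotProduct, mulVec_mulVec, quad]

theorem quad_sq (hA : A.IsHermitian) (x : Fin m → ℂ) :
    quad (A ^ 2) x = ‖WithLp.toLp 2 (A *ᵥ x)‖ ^ 2 := by
  rw [← quad_conjTranspose_mul_self, hA.eq, sq]

theorem norm_star_dotProduct_sq_le (x y : Fin m → ℂ) :
    ‖star x ⬝ᵥ y‖ ^ 2 ≤ ‖WithLp.toLp 2 x‖ ^ 2 * ‖WithLp.toLp 2 y‖ ^ 2 := by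
  have := norm_inner_le_norm (𝕜 := ℂ) (WithLp.toLp 2 x) (WithLp.toLp 2 y)
  rw [EuclideanSpace.inner_toLp_toLp, dotProduct_comm] at this
  rw [← mul_pow]
  gcongr

theorem outer_isHermitian (u : Fin m → ℂ) : (outer u).IsHermitian :=
  (posSemidef_vecMulVec_self_star u).isHermitian

theorem outer_posSemidef (u : Fin m → ℂ) : (outer u).PosSemidef :=
  posSemidef_vecMulVec_self_star u

theorem trace_outer (u : Fin m → ℂ) : (outer u).trace.re = ‖WithLp.toLp 2 u‖ ^ 2 := by
  rw [outer, trace_vecMulVec, dotProduct_comm, norm_toLp_sq]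

theorem trace_outer_mul (R : Matrix (Fin m) (Fin m) ℂ) (u : Fin m → ℂ) :
    (outer u * R).trace = star u ⬝ᵥ (R *ᵥ u) := by
  rw [outer, vecMulVec_mul, trace_vecMulVec, dotProduct_comm, dotProduct_mulVec]

theorem trace_mul_outer (R : Matrix (Fin m) (Fin m) ℂ) (u : Fin m → ℂ) :
    (R * outer u).trace.re = quad R u := by
  rw [trace_mul_comm, trace_outer_mul, quad]

theorem mul_outer_mul (hA : A.IsHermitian) (u : Fin m → ℂ) :
    A * outer u * A = outer (A *ᵥ u) := by
  rw [outer, outer, mul_vecMulVec, vecMulVec_mul, star_mulVec, hA.eq]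

theorem outer_mul_mul_outer (R : Matrix (Fin m) (Fin m) ℂ) (u v : Fin m → ℂ) :
    vecMulVec v (star u) * R * vecMulVec u (star v) = (star u ⬝ᵥ (R *ᵥ u)) • outer v := by
  rw [vecMulVec_mul, vecMulVec_mul_vecMulVec, ← dotProduct_mulVec, outer, vecMulVec_smul]

theorem quad_outer (u x : Fin m → ℂ) : quad (outer u) x = ‖star u ⬝ᵥ x‖ ^ 2 := by
  rw [quad, outer, vecMulVec_mulVec, op_smul_eq_smul, dotProduct_smul, smul_eq_mul,
    star_dotProduct x u, mul_comm, dotProduct_comm (star u)]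
  rw [← Complex.normSq_eq_norm_sq]
  change (starRingEnd ℂ _ * _ : ℂ).re = _
  rw [← Complex.normSq_eq_conj_mul_self, Complex.ofReal_re]

theorem quad_smul (c : ℝ) (A : Matrix (Fin m) (Fin m) ℂ) (x : Fin m → ℂ) :
    quad (c • A) x = c * quad A x := by
  simp [quad, smul_mulVec]

theorem quad_sub (A B : Matrix (Fin m) (Fin m) ℂ) (x : Fin m → ℂ) :
    quad (A - B) x = quad A x - quad B x := by
  simp [quad, sub_mulVec]

theorem quad_add (A B : Matrix (Fin m) (Fin m) ℂ) (x : Fin m → ℂ) :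
    quad (A + B) x = quad A x + quad B x := by
  simp [quad, add_mulVec]

theorem quad_one (x : Fin m → ℂ) : quad 1 x = ‖WithLp.toLp 2 x‖ ^ 2 := by
  rw [quad, one_mulVec, norm_toLp_sq]

/-! ### The dual bound and its equality case -/

theorem re_trace_mul_nonneg (hA : A.PosSemidef) (hR : R.PosSemidef) :
    0 ≤ (A * R).trace.re := by
  obtain ⟨B, rfl⟩ := exists_eq_conjTranspose_mul_self hA
  rw [trace_mul_comm, ← Matrix.mul_assoc, trace_mul_comm, ← Matrix.mul_assoc]
  exact (Complex.nonneg_iff.mp (hR.mul_mul_conjTranspose_same B).trace_nonneg).1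

/-- With $A=B^+B$ and $R=D^+D$ the trace is the squared Frobenius norm of $BD^+$. This is
complementary slackness. -/
theorem mul_eq_zero_of_re_trace_mul (hA : A.PosSemidef) (hR : R.PosSemidef)
    (h : (A * R).trace.re = 0) : A * R = 0 := by
  obtain ⟨B, rfl⟩ := exists_eq_conjTranspose_mul_self hA
  obtain ⟨D, rfl⟩ := exists_eq_conjTranspose_mul_self hR
  have e : (Bᴴ * B * (Dᴴ * D)).trace = ((B * Dᴴ)ᴴ * (B * Dᴴ)).trace := by
    rw [conjTranspose_mul, conjTranspose_conjTranspose, trace_mul_comm (Bᴴ * B), Matrix.mul_assoc,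
      trace_mul_comm Dᴴ]
    simp only [Matrix.mul_assoc]
  have e' : (Bᴴ * B * (Dᴴ * D)).trace = 0 := by
    have := Complex.nonneg_iff.mp (posSemidef_conjTranspose_mul_self (B * Dᴴ)).trace_nonneg
    rw [← e] at this
    exact Complex.ext h this.2.symm
  rw [e, trace_conjTranspose_mul_self_eq_zero_iff] at e'
  rw [Matrix.mul_assoc, ← Matrix.mul_assoc B, e', Matrix.zero_mul, Matrix.mul_zero]

/-- If `W v = u`, then `u u⁺ ≤ (v⁺ W v) W`. -/
theorem posSemidef_smul_sub_outer (hW : W.PosSemidef) (huv : W *ᵥ v = u) :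
    (quad W v • W - outer u).PosSemidef := by
  have hH : (quad W v • W - outer u).IsHermitian :=
    IsHermitian.sub (hW.isHermitian.smul (IsSelfAdjoint.all _)) (outer_isHermitian u)
  refine .of_dotProduct_mulVec_nonneg hH fun x => ?_
  rw [← ofReal_quad hH, Complex.zero_le_real, quad_sub, quad_smul, quad_outer, sub_nonneg]
  -- Here $u^+x=(Bv)^+(Bx)$, so the claim is Cauchy–Schwarz for $Bv$ and $Bx$.
  obtain ⟨B, rfl⟩ := exists_eq_conjTranspose_mul_self hW
  rw [quad_conjTranspose_mul_self, quad_conjTranspose_mul_self, ← huv, star_mulVec_dotProduct,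
    hW.isHermitian.eq, ← mulVec_mulVec, dotProduct_mulVec, ← star_mulVec]
  exact norm_star_dotProduct_sq_le _ _

theorem re_trace_smul_sub_outer_mul (s : ℝ) (W R : Matrix (Fin m) (Fin m) ℂ) (u : Fin m → ℂ) :
    ((s • W - outer u) * R).trace.re = s * (W * R).trace.re - quad R u := by
  rw [Matrix.sub_mul, trace_sub, trace_outer_mul, Complex.sub_re, Matrix.smul_mul, trace_smul,
    Complex.smul_re, smul_eq_mul, quad]

theorem quad_le_mul_trace (hW : W.PosSemidef) (hR : R.PosSemidef) (huv : W *ᵥ v = u) :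
    quad R u ≤ quad W v * (W * R).trace.re := by
  have := re_trace_mul_nonneg (posSemidef_smul_sub_outer hW huv) hR
  rw [re_trace_smul_sub_outer_mul] at this
  linarith

/-- The equality case of `quad_le_mul_trace`, compressed by a projection `P` onto the range
of `W`. -/
theorem compress_eq_of_quad_eq (hW : W.PosSemidef) (hR : R.PosSemidef) (huv : W *ᵥ v = u)
    (h : quad R u = quad W v * (W * R).trace.re) (hP : P.IsHermitian) (hX : X * W = P)
    (hXu : X *ᵥ u = v) :
    (quad W v) ^ 2 • (P * R * P) = quad R u • outer v := by
  have h0 := mul_eq_zero_of_re_trace_mul (posSemidef_smul_sub_outer hW huv) hR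
    (by rw [re_trace_smul_sub_outer_mul, h, sub_self])
  rw [Matrix.sub_mul, sub_eq_zero] at h0
  -- Multiply $(v^+Wv)WR=uu^+R$ on the left by `X`, which turns `W` into `P` and `u` into `v`.
  have h1 : quad W v • (P * R) = vecMulVec v (star u) * R := by
    have := congrArg (X * ·) h0
    simp only [Matrix.smul_mul, Matrix.mul_smul, ← Matrix.mul_assoc, outer, mul_vecMulVec,
      hX, hXu] at this
    exact this
  have h2 : quad W v • (R * P) = R * vecMulVec u (star v) := by
    have := congrArg conjTranspose h1
    simpa [conjTranspose_smul, conjTranspose_mul, hP.eq, hR.isHermitian.eq,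
      conjTranspose_vecMulVec] using this
  calc (quad W v) ^ 2 • (P * R * P) = quad W v • ((quad W v • (P * R)) * P) := by
        rw [Matrix.smul_mul, smul_smul, sq]
    _ = vecMulVec v (star u) * (quad W v • (R * P)) := by
        rw [h1, Matrix.mul_smul, Matrix.mul_assoc]
    _ = (star u ⬝ᵥ (R *ᵥ u)) • outer v := by
        rw [h2, ← Matrix.mul_assoc, outer_mul_mul_outer]
    _ = quad R u • outer v := by
        rw [← ofReal_quad hR.isHermitian, Complex.coe_smul]

/-! ### Reduction of the capacity to a quadratic form -/

theorem rate_smul_outer (lam : ℝ) (hR : R.IsHermitian) (u : Fin m → ℂ) :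
    rate (lam • outer u) R = Real.log (1 + lam * quad R u) := by
  have : (1 + lam • outer u * R).det = 1 + (lam * quad R u : ℝ) := by
    rw [outer, ← smul_vecMulVec, vecMulVec_mul, vecMulVec_eq Unit,
      det_one_add_replicateCol_mul_replicateRow, dotProduct_smul, ← dotProduct_mulVec,
      ← ofReal_quad hR]
    simp
  rw [rate, this]
  simp only [Complex.add_re, Complex.one_re, Complex.ofReal_re]

theorem rate_le_rate_iff (hlam : 0 < lam) {R' : Matrix (Fin m) (Fin m) ℂ}
    (hR : R.PosSemidef) (hR' : R'.PosSemidef) :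
    rate (lam • outer u) R ≤ rate (lam • outer u) R' ↔ quad R u ≤ quad R' u := by
  have h1 := mul_nonneg hlam.le (quad_nonneg hR u)
  have h2 := mul_nonneg hlam.le (quad_nonneg hR' u)
  rw [rate_smul_outer _ hR.isHermitian, rate_smul_outer _ hR'.isHermitian,
    Real.log_le_log_iff (by linarith) (by linarith), add_le_add_iff_left,
    mul_le_mul_iff_right₀ hlam]

theorem isOptimal_smul_outer_iff (hlam : 0 < lam)
    {S : Set (Matrix (Fin m) (Fin m) ℂ)} (hS : ∀ R ∈ S, R.PosSemidef) :
    IsOptimal (lam • outer u) S R ↔ R ∈ S ∧ ∀ R' ∈ S, quad R' u ≤ quad R u :=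
  and_congr_right fun hR => forall₂_congr fun R' hR' => rate_le_rate_iff hlam (hS R' hR') (hS R hR)

theorem IsOptimal.isCapacity {W₁ : Matrix (Fin m) (Fin m) ℂ} {S : Set (Matrix (Fin m) (Fin m) ℂ)}
    (h : IsOptimal W₁ S R) : IsCapacity W₁ S (rate W₁ R) :=
  ⟨⟨R, h.1, rfl⟩, by rintro _ ⟨R', hR', rfl⟩; exact h.2 R' hR'⟩

/-! ### Equality in Cauchy–Schwarz, uniqueness and eigenvectors -/

theorem norm_star_dotProduct_sq_eq_iff (hu : ‖WithLp.toLp 2 u‖ = 1) (hv : v ≠ 0) :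
    ‖star u ⬝ᵥ v‖ ^ 2 = ‖WithLp.toLp 2 v‖ ^ 2 ↔ ∃ c : ℂ, c ≠ 0 ∧ v = c • u := by
  have hu0 : WithLp.toLp 2 u ≠ 0 := by
    intro h; simp [h] at hu
  have hv0 : WithLp.toLp 2 v ≠ 0 := by simpa using hv
  have := norm_inner_eq_norm_iff (𝕜 := ℂ) hu0 hv0
  rw [EuclideanSpace.inner_toLp_toLp, dotProduct_comm, hu, one_mul] at this
  rw [sq_eq_sq₀ (norm_nonneg _) (norm_nonneg _), this]
  refine exists_congr fun c => and_congr_right fun _ => ?_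
  rw [← WithLp.toLp_smul, (WithLp.toLp_injective 2).eq_iff]

theorem ne_zero_of_norm_toLp_eq_one (hu : ‖WithLp.toLp 2 u‖ = 1) : u ≠ 0 := by
  rintro rfl
  simp at hu

theorem norm_toLp_sq_pos (hx : x ≠ 0) : 0 < ‖WithLp.toLp 2 x‖ ^ 2 :=
  pow_pos (norm_pos_iff.mpr (by simpa using hx)) 2

/-- Rewrites the constant $v^+Wv$ of the dual bound in terms of the inverse or pseudo-inverse `A`.
-/
theorem quad_mulVec_eq (hA : A.IsHermitian) (huv : W *ᵥ (A *ᵥ u) = u) :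
    quad W (A *ᵥ u) = quad A u := by
  rw [quad, huv, ← star_dotProduct_mulVec_of_isHermitian hA, quad]

theorem quad_pos_of_mulVec_eq (hW : W.PosSemidef) (huv : W *ᵥ v = u) (hu : u ≠ 0) :
    0 < quad W v := by
  refine (quad_nonneg hW v).lt_of_ne' fun h => hu ?_
  rw [← huv, ← hW.dotProduct_mulVec_zero_iff, ← ofReal_quad hW.isHermitian, h, Complex.ofReal_zero]

theorem smul_outer_posSemidef {t : ℝ} (ht : 0 ≤ t) (v : Fin m → ℂ) : (t • outer v).PosSemidef := by
  have := (outer_posSemidef v).smul (α := ℂ) (Complex.zero_le_real.mpr ht)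
  rwa [Complex.coe_smul] at this

theorem re_trace_smul_outer (t : ℝ) (v : Fin m → ℂ) :
    (t • outer v).trace.re = t * ‖WithLp.toLp 2 v‖ ^ 2 := by
  rw [trace_smul, Complex.smul_re, trace_outer, smul_eq_mul]

theorem re_trace_mul_smul_outer (A : Matrix (Fin m) (Fin m) ℂ) (t : ℝ) (v : Fin m → ℂ) :
    (A * t • outer v).trace.re = t * quad A v := by
  rw [Matrix.mul_smul, trace_smul, Complex.smul_re, trace_mul_outer, smul_eq_mul]

theorem quad_smul_outer_of_mulVec_eq (hW : W.IsHermitian) (t : ℝ) (huv : W *ᵥ v = u) :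
    quad (t • outer v) u = t * quad W v ^ 2 := by
  rw [quad_smul, quad_outer, ← huv, ← ofReal_quad hW, Complex.norm_real, Real.norm_eq_abs, sq_abs]

/-- For invertible `W` the compression is by $P=I$, so equality in the dual bound determines `R`
itself. -/
theorem eq_smul_outer_of_quad_eq (hW : W.PosDef) (hR : R.PosSemidef) (hu : u ≠ 0)
    (huv : W *ᵥ v = u) {t : ℝ} (ht : quad R u = t * quad W v ^ 2)
    (h : quad R u = quad W v * (W * R).trace.re) : R = t • outer v := by
  have hdet : IsUnit W.det := (isUnit_iff_isUnit_det _).mp hW.isUnit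
  have key := compress_eq_of_quad_eq hW.posSemidef hR huv h isHermitian_one
    (nonsing_inv_mul W hdet) (by rw [← huv, mulVec_mulVec, nonsing_inv_mul W hdet, one_mulVec])
  have hs : quad W v ^ 2 ≠ 0 := (pow_pos (quad_pos_of_mulVec_eq hW.posSemidef huv hu) 2).ne'
  rw [Matrix.one_mul, Matrix.mul_one, ht, mul_comm t, mul_smul] at key
  exact smul_right_injective _ hs key

theorem isEigenvector_iff (hu : u ≠ 0) : IsEigenvector W u ↔ ∃ ν : ℂ, W *ᵥ u = ν • u := by
  refine exists_congr fun ν => ?_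
  rw [Module.End.hasEigenvector_iff, Module.End.mem_eigenspace_iff, toLin'_apply]
  exact and_iff_left hu

/-- Invertibility is needed only along `u`, so that `X` may be either a true inverse or a
pseudo-inverse. -/
theorem exists_smul_iff_isEigenvector (hu : u ≠ 0) (h1 : A *ᵥ (X *ᵥ u) = u)
    (h2 : X *ᵥ (A *ᵥ u) = u) : (∃ c : ℂ, c ≠ 0 ∧ X *ᵥ u = c • u) ↔ IsEigenvector A u := by
  rw [isEigenvector_iff hu]
  constructor
  · rintro ⟨c, hc, h⟩
    rw [h, mulVec_smul] at h1
    exact ⟨c⁻¹, by rw [← h1, smul_smul, inv_mul_cancel₀ hc, one_smul, h1]⟩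
  · rintro ⟨ν, h⟩
    rw [h, mulVec_smul] at h2
    have hν : ν ≠ 0 := by
      rintro rfl
      rw [zero_smul] at h2
      exact hu h2.symm
    refine ⟨ν⁻¹, inv_ne_zero hν, ?_⟩
    have := congrArg (ν⁻¹ • ·) h2
    simpa [smul_smul, inv_mul_cancel₀ hν] using this

theorem norm_star_dotProduct_mulVec_sq (hX : X.IsHermitian) (u : Fin m → ℂ) :
    ‖star u ⬝ᵥ (X *ᵥ u)‖ ^ 2 = quad X u ^ 2 := by
  rw [← ofReal_quad hX, Complex.norm_real, Real.norm_eq_abs, sq_abs]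

theorem quad_sq_le (hX : X.IsHermitian) (hu : ‖WithLp.toLp 2 u‖ = 1) :
    quad X u ^ 2 ≤ ‖WithLp.toLp 2 (X *ᵥ u)‖ ^ 2 := by
  have := norm_star_dotProduct_sq_le u (X *ᵥ u)
  rwa [hu, one_pow, one_mul, norm_star_dotProduct_mulVec_sq hX] at this

theorem quad_sq_eq_iff (hX : X.IsHermitian) (hu : ‖WithLp.toLp 2 u‖ = 1)
    (h1 : A *ᵥ (X *ᵥ u) = u) (h2 : X *ᵥ (A *ᵥ u) = u) :
    quad X u ^ 2 = ‖WithLp.toLp 2 (X *ᵥ u)‖ ^ 2 ↔ IsEigenvector A u := by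
  have hu0 := ne_zero_of_norm_toLp_eq_one hu
  have hv : X *ᵥ u ≠ 0 := by
    intro h
    rw [h, mulVec_zero] at h1
    exact hu0 h1.symm
  rw [← norm_star_dotProduct_mulVec_sq hX, norm_star_dotProduct_sq_eq_iff hu hv,
    exists_smul_iff_isEigenvector hu0 h1 h2]

/-! ### The pseudo-inverse of a Hermitian matrix -/

/-- Adjoints of the Penrose equations show that the adjoint of $W^\dagger$ is again a pseudo-inverse
of `W`; uniqueness concludes. -/
theorem pinv_isHermitian (hW : W.IsHermitian) : (pinv W).IsHermitian := by
  have h := pinv_isMoorePenrose W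
  refine IsMoorePenrose.unique (A := W) ⟨?_, ?_, ?_, ?_⟩ h
  · simpa [conjTranspose_mul, hW.eq, Matrix.mul_assoc] using congrArg conjTranspose h.mul_mul_self
  · simpa [conjTranspose_mul, hW.eq, Matrix.mul_assoc] using congrArg conjTranspose h.self_mul_mul
  · simpa [conjTranspose_mul, hW.eq] using h.right_hermitian.conjTranspose
  · simpa [conjTranspose_mul, hW.eq] using h.left_hermitian.conjTranspose

theorem pinv_mul_comm (hW : W.IsHermitian) : pinv W * W = W * pinv W := by
  have := (pinv_isMoorePenrose W).right_hermitian.eq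
  rw [conjTranspose_mul, hW.eq, (pinv_isHermitian hW).eq] at this
  exact this.symm

theorem mulVec_sub_mul_pinv_mulVec (hW : W.IsHermitian) (u : Fin m → ℂ) :
    W *ᵥ (u - W *ᵥ (pinv W *ᵥ u)) = 0 := by
  rw [mulVec_sub, mulVec_mulVec, mulVec_mulVec, Matrix.mul_assoc, ← pinv_mul_comm hW,
    ← Matrix.mul_assoc, (pinv_isMoorePenrose W).mul_mul_self, sub_self]

/-- Both sides say that `u` is orthogonal to the kernel of `W`, that is, lies in its range, onto
which $WW^\dagger$ projects. -/
theorem ker_le_ker_smul_outer_iff (hW : W.IsHermitian) (hlam : lam ≠ 0) (hu : u ≠ 0) :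
    LinearMap.ker (toLin' W) ≤ LinearMap.ker (toLin' (lam • outer u)) ↔
      W *ᵥ (pinv W *ᵥ u) = u := by
  have hker : ∀ p, p ∈ LinearMap.ker (toLin' (lam • outer u)) ↔ star u ⬝ᵥ p = 0 := by
    intro p
    rw [LinearMap.mem_ker, toLin'_apply, smul_mulVec, outer, vecMulVec_mulVec, op_smul_eq_smul,
      smul_eq_zero, smul_eq_zero]
    simp [hlam, hu]
  constructor
  · intro h
    set p := u - W *ᵥ (pinv W *ᵥ u) with hp
    have hWp : W *ᵥ p = 0 := mulVec_sub_mul_pinv_mulVec hW u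
    have h1 : star u ⬝ᵥ p = 0 := (hker p).mp (h (by rw [LinearMap.mem_ker, toLin'_apply, hWp]))
    -- The residual `p` is orthogonal to `u` and, being in the kernel, to the range of `W`; hence to
    -- itself.
    have h2 : star p ⬝ᵥ p = 0 := by
      conv_lhs => rw [hp]
      rw [star_sub, sub_dotProduct, ← hp, h1, star_mulVec_dotProduct, hW.eq, hWp,
        dotProduct_zero, sub_zero]
    exact (sub_eq_zero.mp (dotProduct_star_self_eq_zero.mp h2)).symm
  · intro h p hp
    rw [LinearMap.mem_ker, toLin'_apply] at hp
    rw [hker, ← h, star_mulVec_dotProduct, hW.eq, hp, dotProduct_zero]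

theorem gamma₁_eq (hW : W.IsHermitian) (u : Fin m → ℂ) :
    gamma₁ W u = quad (pinv W) u / ‖WithLp.toLp 2 (pinv W *ᵥ u)‖ ^ 2 := by
  rw [gamma₁, quad_sq (pinv_isHermitian hW)]

theorem covIPC_eq (hW : W.IsHermitian) (u : Fin m → ℂ) (PI : ℝ) :
    covIPC W u PI = (PI / quad (pinv W) u) • outer (pinv W *ᵥ u) := by
  rw [covIPC, mul_outer_mul (pinv_isHermitian hW)]

/-! ### The resolvent `(I + μ W)⁻¹` -/

theorem W2mu_posDef (hW : W.PosSemidef) (hμ : 0 ≤ μ) : (W2mu W μ).PosDef := by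
  have := hW.smul (α := ℂ) (Complex.zero_le_real.mpr hμ)
  rw [Complex.coe_smul] at this
  exact PosDef.one.add_posSemidef this

theorem isUnit_det_W2mu (hW : W.PosSemidef) (hμ : 0 ≤ μ) : IsUnit (W2mu W μ).det :=
  (isUnit_iff_isUnit_det _).mp (W2mu_posDef hW hμ).isUnit

theorem W2mu_mulVec (W : Matrix (Fin m) (Fin m) ℂ) (μ : ℝ) (x : Fin m → ℂ) :
    W2mu W μ *ᵥ x = x + μ • (W *ᵥ x) := by
  rw [W2mu, add_mulVec, one_mulVec, smul_mulVec]

theorem W2mu_mulVec_inv_mulVec (hW : W.PosSemidef) (hμ : 0 ≤ μ) (x : Fin m → ℂ) :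
    W2mu W μ *ᵥ ((W2mu W μ)⁻¹ *ᵥ x) = x := by
  rw [mulVec_mulVec, mul_nonsing_inv _ (isUnit_det_W2mu hW hμ), one_mulVec]

theorem W2mu_inv_mulVec_mulVec (hW : W.PosSemidef) (hμ : 0 ≤ μ) (x : Fin m → ℂ) :
    (W2mu W μ)⁻¹ *ᵥ (W2mu W μ *ᵥ x) = x := by
  rw [mulVec_mulVec, nonsing_inv_mul _ (isUnit_det_W2mu hW hμ), one_mulVec]

theorem W2mu_inv_mulVec_ne_zero (hW : W.PosSemidef) (hμ : 0 ≤ μ) (hu : u ≠ 0) :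
    (W2mu W μ)⁻¹ *ᵥ u ≠ 0 := by
  intro h
  have := W2mu_mulVec_inv_mulVec hW hμ u
  rw [h, mulVec_zero] at this
  exact hu this.symm

theorem quad_W2mu (W : Matrix (Fin m) (Fin m) ℂ) (μ : ℝ) (x : Fin m → ℂ) :
    quad (W2mu W μ) x = ‖WithLp.toLp 2 x‖ ^ 2 + μ * quad W x := by
  rw [W2mu, quad_add, quad_smul, quad_one]

theorem covMu_eq (hW : W.PosSemidef) (hμ : 0 ≤ μ) (u : Fin m → ℂ) (PT : ℝ) :
    covMu W u PT μ = (PT / ‖WithLp.toLp 2 ((W2mu W μ)⁻¹ *ᵥ u)‖ ^ 2) •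
      outer ((W2mu W μ)⁻¹ *ᵥ u) := by
  have h := (W2mu_posDef hW hμ).isHermitian.inv
  rw [covMu, mul_outer_mul h, quad_sq h]

theorem isEigenvector_W2mu_iff (hμ : μ ≠ 0) (hu : u ≠ 0) :
    IsEigenvector (W2mu W μ) u ↔ IsEigenvector W u := by
  rw [isEigenvector_iff hu, isEigenvector_iff hu]
  constructor
  · rintro ⟨ν, h⟩
    refine ⟨(μ : ℂ)⁻¹ * (ν - 1), ?_⟩
    rw [W2mu_mulVec] at h
    rw [mul_smul, sub_smul, one_smul, ← h, add_sub_cancel_left, ← Complex.coe_smul, smul_smul,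
      inv_mul_cancel₀ (by exact_mod_cast hμ), one_smul]
  · rintro ⟨ν, h⟩
    refine ⟨1 + μ * ν, ?_⟩
    rw [W2mu_mulVec, h, add_smul, one_smul, mul_smul, Complex.coe_smul]

/-- With $y=(I+\mu W)^{-1}x$, one has $|y|^2\le y^+(I+\mu W)y=y^+x\le|y||x|$. -/
theorem norm_W2mu_inv_mulVec_le (hW : W.PosSemidef) (hμ : 0 ≤ μ) (x : Fin m → ℂ) :
    ‖WithLp.toLp 2 ((W2mu W μ)⁻¹ *ᵥ x)‖ ≤ ‖WithLp.toLp 2 x‖ := by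
  set y := (W2mu W μ)⁻¹ *ᵥ x with hy
  have h1 : ‖WithLp.toLp 2 y‖ ^ 2 ≤ ‖WithLp.toLp 2 y‖ * ‖WithLp.toLp 2 x‖ := by
    calc ‖WithLp.toLp 2 y‖ ^ 2 ≤ quad (W2mu W μ) y := by
          rw [quad_W2mu]
          exact le_add_of_nonneg_right (mul_nonneg hμ (quad_nonneg hW y))
      _ = (star y ⬝ᵥ x).re := by rw [quad, hy, W2mu_mulVec_inv_mulVec hW hμ]
      _ ≤ ‖star y ⬝ᵥ x‖ := Complex.re_le_norm _
      _ ≤ ‖WithLp.toLp 2 y‖ * ‖WithLp.toLp 2 x‖ := by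
          refine (sq_le_sq₀ (norm_nonneg _) (by positivity)).mp ?_
          rw [mul_pow]
          exact norm_star_dotProduct_sq_le y x
  rcases (norm_nonneg (WithLp.toLp 2 y)).eq_or_lt with h | h
  · rw [← h]; exact norm_nonneg _
  · exact le_of_mul_le_mul_left (by rwa [sq] at h1) h

theorem smul_W2mu_inv_mulVec_mulVec (hW : W.PosSemidef) (hμ : 0 ≤ μ) (x : Fin m → ℂ) :
    μ • ((W2mu W μ)⁻¹ *ᵥ (W *ᵥ x)) = x - (W2mu W μ)⁻¹ *ᵥ x := by
  have := W2mu_inv_mulVec_mulVec hW hμ x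
  rw [W2mu_mulVec, mulVec_add, mulVec_smul] at this
  exact eq_sub_of_add_eq' this

/-! ### Large multipliers and existence of the multiplier -/

/-- On the range of `W` the resolvent decays like $1/\mu$, because $\mu(I+\mu W)^{-1}Wx=x-(I+\mu
W)^{-1}x$ has norm at most $2|x|$. -/
theorem tendsto_W2mu_inv_mulVec_mulVec (hW : W.PosSemidef) (x : Fin m → ℂ) :
    Tendsto (fun μ : ℝ => (W2mu W μ)⁻¹ *ᵥ (W *ᵥ x)) atTop (𝓝 0) := by
  have h : Tendsto (fun μ : ℝ => WithLp.toLp 2 ((W2mu W μ)⁻¹ *ᵥ (W *ᵥ x))) atTop (𝓝 0) := by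
    refine squeeze_zero_norm' (a := fun μ : ℝ => μ⁻¹ * (2 * ‖WithLp.toLp 2 x‖)) ?_ ?_
    · filter_upwards [eventually_gt_atTop 0] with μ hμ
      have h1 := congrArg (fun y => ‖WithLp.toLp 2 y‖) (smul_W2mu_inv_mulVec_mulVec hW hμ.le x)
      simp only [WithLp.toLp_smul, WithLp.toLp_sub, norm_smul, Real.norm_eq_abs,
        abs_of_pos hμ] at h1
      have h2 := norm_sub_le (WithLp.toLp 2 x) (WithLp.toLp 2 ((W2mu W μ)⁻¹ *ᵥ x))
      have h3 := norm_W2mu_inv_mulVec_le hW hμ.le x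
      rw [le_inv_mul_iff₀ hμ, h1]
      linarith
    · simpa using tendsto_inv_atTop_zero.mul_const (2 * ‖WithLp.toLp 2 x‖)
  exact ((PiLp.continuous_ofLp 2 _).tendsto _).comp h

theorem continuous_quad (A : Matrix (Fin m) (Fin m) ℂ) : Continuous (quad A) := by
  unfold quad
  fun_prop

theorem continuous_norm_toLp_sq : Continuous fun x : Fin m → ℂ => ‖WithLp.toLp 2 x‖ ^ 2 :=
  ((PiLp.continuous_toLp 2 _).norm).pow 2

theorem continuousOn_W2mu_inv_mulVec (hW : W.PosSemidef) (u : Fin m → ℂ) :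
    ContinuousOn (fun μ : ℝ => (W2mu W μ)⁻¹ *ᵥ u) (Set.Ici 0) := by
  have h : Continuous fun μ : ℝ => W2mu W μ := by unfold W2mu; fun_prop
  have : ContinuousOn (fun μ : ℝ => (W2mu W μ)⁻¹) (Set.Ici 0) := by
    simp only [Matrix.inv_def, Ring.inverse_eq_inv']
    exact (h.matrix_det.continuousOn.inv₀ fun μ hμ => (isUnit_det_W2mu hW hμ).ne_zero).smul
      h.matrix_adjugate.continuousOn
  exact Continuous.comp_continuousOn (g := fun A : Matrix (Fin m) (Fin m) ℂ => A *ᵥ u)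
    (by fun_prop) this

theorem rayleigh_smul (A : Matrix (Fin m) (Fin m) ℂ) {c : ℝ} (hc : c ≠ 0) (x : Fin m → ℂ) :
    quad A (c • x) / ‖WithLp.toLp 2 (c • x)‖ ^ 2 = quad A x / ‖WithLp.toLp 2 x‖ ^ 2 := by
  have : quad A (c • x) = c ^ 2 * quad A x := by
    simp [quad, mulVec_smul, star_smul, smul_dotProduct, dotProduct_smul, sq, mul_assoc]
  rw [this, WithLp.toLp_smul, norm_smul, mul_pow, Real.norm_eq_abs, sq_abs,
    mul_div_mul_left _ _ (pow_ne_zero 2 hc)]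

/-- Only the direction of $y_\mu$ matters; the factor $c_\mu$ keeps the limit non-zero when $y_\mu$
itself tends to zero. -/
theorem exists_rayleigh_lt_of_tendsto {y : ℝ → Fin m → ℂ} {c : ℝ → ℝ} {γ : ℝ}
    (hc : ∀ᶠ μ in atTop, c μ ≠ 0) (h : Tendsto (fun μ => c μ • y μ) atTop (𝓝 x)) (hx : x ≠ 0)
    (hγ : quad W x / ‖WithLp.toLp 2 x‖ ^ 2 < γ) :
    ∃ μ : ℝ, 0 ≤ μ ∧ quad W (y μ) / ‖WithLp.toLp 2 (y μ)‖ ^ 2 < γ := by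
  have h1 := (((continuous_quad W).tendsto x).comp h).div
    ((continuous_norm_toLp_sq.tendsto x).comp h) (norm_toLp_sq_pos hx).ne'
  obtain ⟨μ, h2, h3, h4⟩ :=
    ((h1.eventually_lt_const hγ).and (hc.and (eventually_ge_atTop 0))).exists
  refine ⟨μ, h4, ?_⟩
  rw [← rayleigh_smul W h3]
  exact h2

theorem exists_rayleigh_lt (hW : W.PosSemidef) (hu : u ≠ 0) {γ : ℝ} (hγ : 0 < γ)
    (h : W *ᵥ (pinv W *ᵥ u) = u → gamma₁ W u < γ) :
    ∃ μ : ℝ, 0 ≤ μ ∧ quad W ((W2mu W μ)⁻¹ *ᵥ u) /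
      ‖WithLp.toLp 2 ((W2mu W μ)⁻¹ *ᵥ u)‖ ^ 2 < γ := by
  have hH := hW.isHermitian
  by_cases hr : W *ᵥ (pinv W *ᵥ u) = u
  · set x := pinv W *ᵥ u with hx
    have hx0 : x ≠ 0 := by
      intro h0
      rw [h0, mulVec_zero] at hr
      exact hu hr.symm
    have hWx : W *ᵥ (pinv W *ᵥ x) = x := by
      rw [hx, mulVec_mulVec, ← pinv_mul_comm hH, mulVec_mulVec,
        (pinv_isMoorePenrose W).self_mul_mul]
    -- With $u=Wx$, $\mu v_\mu=x-(I+\mu W)^{-1}x$. The last term vanishes in the limit because `x`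
    -- lies in the range of `W`.
    refine exists_rayleigh_lt_of_tendsto (c := fun μ => μ) (eventually_ne_atTop 0) ?_ hx0 ?_
    · have := (tendsto_const_nhds (x := x)).sub (tendsto_W2mu_inv_mulVec_mulVec hW (pinv W *ᵥ x))
      rw [sub_zero] at this
      refine this.congr' ?_
      filter_upwards [eventually_ge_atTop 0] with μ hμ
      rw [hWx, ← smul_W2mu_inv_mulVec_mulVec hW hμ, hr]
    · rw [hx, quad_mulVec_eq (pinv_isHermitian hH) hr, ← gamma₁_eq hH]
      exact h hr
  · set p := u - W *ᵥ (pinv W *ᵥ u) with hp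
    have hp0 : p ≠ 0 := fun h0 => hr (sub_eq_zero.mp h0).symm
    have hWp : W *ᵥ p = 0 := mulVec_sub_mul_pinv_mulVec hH u
    -- The resolvent fixes the kernel component `p` of `u` and kills the range component in the
    -- limit.
    refine exists_rayleigh_lt_of_tendsto (c := fun _ => 1) (x := p) (by simp) ?_ hp0 ?_
    · have := (tendsto_const_nhds (x := p)).add
        (tendsto_W2mu_inv_mulVec_mulVec hW (pinv W *ᵥ u))
      rw [add_zero] at this
      refine this.congr' ?_
      filter_upwards [eventually_ge_atTop 0] with μ hμ
      have h1 := W2mu_inv_mulVec_mulVec hW hμ p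
      rw [W2mu_mulVec, hWp, smul_zero, add_zero] at h1
      rw [one_smul]
      nth_rewrite 1 [← h1]
      rw [← mulVec_add, hp, sub_add_cancel]
    · rw [quad, hWp, dotProduct_zero, Complex.zero_re, zero_div]
      exact hγ

theorem exists_rayleigh_eq (hW : W.PosSemidef) (hu : ‖WithLp.toLp 2 u‖ = 1) {γ : ℝ} (hγ : 0 < γ)
    (h : W *ᵥ (pinv W *ᵥ u) = u → gamma₁ W u < γ) (h2 : γ < gamma₂ W u) :
    ∃ μ : ℝ, 0 < μ ∧ quad W ((W2mu W μ)⁻¹ *ᵥ u) /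
      ‖WithLp.toLp 2 ((W2mu W μ)⁻¹ *ᵥ u)‖ ^ 2 = γ := by
  have hu0 := ne_zero_of_norm_toLp_eq_one hu
  obtain ⟨μ₁, hμ₁, hlt⟩ := exists_rayleigh_lt hW hu0 hγ h
  have hc : ContinuousOn (fun μ : ℝ => quad W ((W2mu W μ)⁻¹ *ᵥ u) /
      ‖WithLp.toLp 2 ((W2mu W μ)⁻¹ *ᵥ u)‖ ^ 2) (Set.Icc 0 μ₁) := by
    have hv := (continuousOn_W2mu_inv_mulVec hW u).mono fun μ (hμ : μ ∈ Set.Icc 0 μ₁) => hμ.1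
    exact ((continuous_quad W).comp_continuousOn hv).div
      (continuous_norm_toLp_sq.comp_continuousOn hv)
      fun μ hμ => (norm_toLp_sq_pos (W2mu_inv_mulVec_ne_zero hW hμ.1 hu0)).ne'
  have h0 : quad W ((W2mu W 0)⁻¹ *ᵥ u) / ‖WithLp.toLp 2 ((W2mu W 0)⁻¹ *ᵥ u)‖ ^ 2
      = gamma₂ W u := by
    simp [W2mu, hu, gamma₂]
  obtain ⟨μ, hμ, he⟩ := intermediate_value_Icc' hμ₁ hc ⟨hlt.le, by rw [h0]; exact h2.le⟩
  refine ⟨μ, hμ.1.lt_of_ne ?_, he⟩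
  rintro rfl
  exact h2.ne (he.symm.trans h0)

/-! ### Interference-limited regime -/

theorem quad_pinv_pos (hW : W.PosSemidef) (hu : u ≠ 0) (hr : W *ᵥ (pinv W *ᵥ u) = u) :
    0 < quad (pinv W) u ∧ 0 < ‖WithLp.toLp 2 (pinv W *ᵥ u)‖ ^ 2 := by
  constructor
  · rw [← quad_mulVec_eq (pinv_isHermitian hW.isHermitian) hr]
    exact quad_pos_of_mulVec_eq hW hr hu
  · refine norm_toLp_sq_pos fun h => hu ?_
    rw [← hr, h, mulVec_zero]

theorem quad_le_of_mem_ipcSet (hW : W.PosSemidef) (hr : W *ᵥ (pinv W *ᵥ u) = u)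
    (hR : R ∈ ipcSet W PI) : quad R u ≤ PI * quad (pinv W) u := by
  have h := quad_le_mul_trace hW hR.1 hr
  rw [quad_mulVec_eq (pinv_isHermitian hW.isHermitian) hr] at h
  have := quad_mulVec_eq (pinv_isHermitian hW.isHermitian) hr ▸ quad_nonneg hW (pinv W *ᵥ u)
  rw [mul_comm]
  exact h.trans (mul_le_mul_of_nonneg_left hR.2 this)

theorem quad_covIPC (hW : W.PosSemidef) (hu : u ≠ 0) (hr : W *ᵥ (pinv W *ᵥ u) = u) :
    quad (covIPC W u PI) u = PI * quad (pinv W) u := by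
  have hs := (quad_pinv_pos hW hu hr).1
  rw [covIPC_eq hW.isHermitian, quad_smul_outer_of_mulVec_eq hW.isHermitian _ hr,
    quad_mulVec_eq (pinv_isHermitian hW.isHermitian) hr]
  field_simp

theorem jointSet_subset_ipcSet : jointSet W PT PI ⊆ ipcSet W PI := fun _ h => ⟨h.1, h.2.2⟩

theorem jointSet_subset_tpcSet : jointSet W PT PI ⊆ tpcSet PT := fun _ h => ⟨h.1, h.2.1⟩

theorem covIPC_mem_jointSet (hW : W.PosSemidef) (hu : u ≠ 0) (hr : W *ᵥ (pinv W *ᵥ u) = u)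
    (hPT : 0 < PT) (hPI : 0 ≤ PI) (h : PI / PT ≤ gamma₁ W u) :
    covIPC W u PI ∈ jointSet W PT PI := by
  obtain ⟨hs, hn⟩ := quad_pinv_pos hW hu hr
  rw [gamma₁_eq hW.isHermitian, div_le_div_iff₀ hPT hn] at h
  rw [covIPC_eq hW.isHermitian]
  refine ⟨smul_outer_posSemidef (div_nonneg hPI hs.le) _, ?_, ?_⟩
  · rw [re_trace_smul_outer, div_mul_eq_mul_div, div_le_iff₀ hs]
    linarith
  · rw [re_trace_mul_smul_outer, quad_mulVec_eq (pinv_isHermitian hW.isHermitian) hr,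
      div_mul_cancel₀ _ hs.ne']

/-- The set `S` is left free so that one argument serves with and without the TPC, which gives
redundancy. -/
theorem isOptimal_covIPC (hW : W.PosSemidef) (hu : u ≠ 0) (hr : W *ᵥ (pinv W *ᵥ u) = u)
    (hlam : 0 < lam) {S : Set (Matrix (Fin m) (Fin m) ℂ)} (hS : S ⊆ ipcSet W PI)
    (hmem : covIPC W u PI ∈ S) : IsOptimal (lam • outer u) S (covIPC W u PI) := by
  refine (isOptimal_smul_outer_iff hlam fun R hR => (hS hR).1).mpr ⟨hmem, fun R hR => ?_⟩
  rw [quad_covIPC hW hu hr]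
  exact quad_le_of_mem_ipcSet hW hr (hS hR)

theorem IsOptimal.quad_eq {S : Set (Matrix (Fin m) (Fin m) ℂ)} (hlam : 0 < lam)
    (hS : ∀ R ∈ S, R.PosSemidef) (hA : IsOptimal (lam • outer u) S A)
    (hR : IsOptimal (lam • outer u) S R) : quad R u = quad A u := by
  rw [isOptimal_smul_outer_iff hlam hS] at hA hR
  exact le_antisymm (hA.2 R hR.1) (hR.2 A hA.1)

theorem re_trace_mul_eq_of_quad_eq (hW : W.PosSemidef) (hu : u ≠ 0)
    (hr : W *ᵥ (pinv W *ᵥ u) = u) (hR : R ∈ ipcSet W PI)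
    (hq : quad R u = PI * quad (pinv W) u) : (W * R).trace.re = PI := by
  have h := quad_le_mul_trace hW hR.1 hr
  rw [quad_mulVec_eq (pinv_isHermitian hW.isHermitian) hr, hq, mul_comm] at h
  exact le_antisymm hR.2 (le_of_mul_le_mul_left h (quad_pinv_pos hW hu hr).1)

theorem interference_limited (hlam : 0 < lam) (hu : ‖WithLp.toLp 2 u‖ = 1) (hW : W.PosSemidef)
    (hPT : 0 < PT) (hPI : 0 ≤ PI) (hr : W *ᵥ (pinv W *ᵥ u) = u) (hγ : PI / PT ≤ gamma₁ W u) :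
    TPCRedundant (lam • outer u) W PT PI ∧
      IsOptimal (lam • outer u) (jointSet W PT PI) (covIPC W u PI) ∧
      (W.PosDef → ∀ R, IsOptimal (lam • outer u) (jointSet W PT PI) R → R = covIPC W u PI) ∧
      IsCapacity (lam • outer u) (jointSet W PT PI)
        (Real.log (1 + lam * (PI / PT * quad (pinv W) u) * PT)) ∧
      (PI / PT < gamma₁ W u → PI / PT * quad (pinv W) u < 1) ∧
      (PI / PT = gamma₁ W u → PI / PT * quad (pinv W) u ≤ 1 ∧
        (PI / PT * quad (pinv W) u = 1 ↔ IsEigenvector W u)) := by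
  have hu0 := ne_zero_of_norm_toLp_eq_one hu
  have hH := hW.isHermitian
  have hpH := pinv_isHermitian hH
  obtain ⟨hs, hn⟩ := quad_pinv_pos hW hu0 hr
  have hmem := covIPC_mem_jointSet hW hu0 hr hPT hPI hγ
  have hopt := isOptimal_covIPC hW hu0 hr hlam jointSet_subset_ipcSet hmem
  have hopt' := isOptimal_covIPC hW hu0 hr hlam subset_rfl (jointSet_subset_ipcSet hmem)
  -- This is $\alpha$ at the threshold $\gamma_I=\gamma_1$, a Cauchy–Schwarz ratio for $u$ and
  -- $W^\dagger u$.
  have hγα : gamma₁ W u * quad (pinv W) u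
      = quad (pinv W) u ^ 2 / ‖WithLp.toLp 2 (pinv W *ᵥ u)‖ ^ 2 := by
    rw [gamma₁_eq hH]; ring
  have hγα' : gamma₁ W u * quad (pinv W) u ≤ 1 := by
    rw [hγα, div_le_one hn]
    exact quad_sq_le hpH hu
  refine ⟨⟨_, hopt.isCapacity, hopt'.isCapacity⟩, hopt, fun hpd R hR => ?_, ?_, fun hlt => ?_,
    fun heq => ⟨heq ▸ hγα', ?_⟩⟩
  · have hq := IsOptimal.quad_eq hlam (fun R hR => hR.1) hopt hR
    rw [quad_covIPC hW hu0 hr] at hq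
    have htr := re_trace_mul_eq_of_quad_eq hW hu0 hr (jointSet_subset_ipcSet hR.1) hq
    rw [covIPC_eq hH]
    refine eq_smul_outer_of_quad_eq hpd hR.1.1 hu0 hr ?_ ?_
    · rw [hq, quad_mulVec_eq hpH hr]
      field_simp
    · rw [hq, htr, quad_mulVec_eq hpH hr, mul_comm]
  · have := hopt.isCapacity
    rw [rate_smul_outer _ hmem.1.isHermitian, quad_covIPC hW hu0 hr] at this
    convert this using 3
    field_simp
  · exact (mul_lt_mul_of_pos_right hlt hs).trans_le hγα'
  · rw [heq, hγα, div_eq_one_iff_eq hn.ne']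
    refine quad_sq_eq_iff hpH hu hr ?_
    rw [mulVec_mulVec, pinv_mul_comm hH, ← mulVec_mulVec, hr]

/-! ### Power-limited regime -/

theorem quad_le_re_trace (hu : ‖WithLp.toLp 2 u‖ = 1) (hR : R.PosSemidef) :
    quad R u ≤ R.trace.re := by
  have := quad_le_mul_trace PosSemidef.one hR (one_mulVec u)
  rwa [quad_one, hu, one_pow, one_mul, Matrix.one_mul] at this

theorem quad_smul_outer_self (hu : ‖WithLp.toLp 2 u‖ = 1) : quad (PT • outer u) u = PT := by
  rw [quad_smul_outer_of_mulVec_eq isHermitian_one _ (one_mulVec u), quad_one, hu]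
  ring

theorem smul_outer_mem_tpcSet (hu : ‖WithLp.toLp 2 u‖ = 1) (hPT : 0 < PT) :
    PT • outer u ∈ tpcSet PT := by
  refine ⟨smul_outer_posSemidef hPT.le u, ?_⟩
  rw [re_trace_smul_outer, hu, one_pow, mul_one]

theorem isOptimal_smul_outer (hlam : 0 < lam) (hu : ‖WithLp.toLp 2 u‖ = 1)
    {S : Set (Matrix (Fin m) (Fin m) ℂ)} (hS : S ⊆ tpcSet PT)
    (hmem : PT • outer u ∈ S) : IsOptimal (lam • outer u) S (PT • outer u) := by
  refine (isOptimal_smul_outer_iff hlam fun R hR => (hS hR).1).mpr ⟨hmem, fun R hR => ?_⟩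
  rw [quad_smul_outer_self hu]
  exact (quad_le_re_trace hu (hS hR).1).trans (hS hR).2

theorem power_limited (hlam : 0 < lam) (hu : ‖WithLp.toLp 2 u‖ = 1)
    (hPT : 0 < PT) (hγ : gamma₂ W u ≤ PI / PT) :
    IPCRedundant (lam • outer u) W PT PI ∧
      IsOptimal (lam • outer u) (tpcSet PT) (PT • outer u) ∧
      IsOptimal (lam • outer u) (jointSet W PT PI) (PT • outer u) ∧
      (∀ R, IsOptimal (lam • outer u) (jointSet W PT PI) R → R = PT • outer u) ∧
      IsCapacity (lam • outer u) (jointSet W PT PI) (Real.log (1 + lam * PT)) := by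
  have hu0 := ne_zero_of_norm_toLp_eq_one hu
  have hmemT := smul_outer_mem_tpcSet hu hPT
  have hmem : PT • outer u ∈ jointSet W PT PI := by
    refine ⟨hmemT.1, hmemT.2, ?_⟩
    rw [re_trace_mul_smul_outer, mul_comm]
    exact (le_div_iff₀ hPT).mp hγ
  have hopt := isOptimal_smul_outer hlam hu jointSet_subset_tpcSet hmem
  have hopt' := isOptimal_smul_outer hlam hu subset_rfl hmemT
  refine ⟨⟨_, hopt.isCapacity, hopt'.isCapacity⟩, hopt', hopt, fun R hR => ?_, ?_⟩
  · have hq := IsOptimal.quad_eq hlam (fun R hR => hR.1) hopt hR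
    rw [quad_smul_outer_self hu] at hq
    have htr : R.trace.re = PT :=
      le_antisymm hR.1.2.1 (hq.symm.trans_le (quad_le_re_trace hu hR.1.1))
    refine eq_smul_outer_of_quad_eq PosDef.one hR.1.1 hu0 (one_mulVec u) ?_ ?_
    · rw [hq, quad_one, hu]; ring
    · rw [hq, Matrix.one_mul, htr, quad_one, hu]; ring
  · have := hopt.isCapacity
    rwa [rate_smul_outer _ hmem.1.isHermitian, quad_smul_outer_self hu] at this

theorem gamma₂_le_of_mem_jointSet (hPT : 0 < PT) (h : PT • outer u ∈ jointSet W PT PI) :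
    gamma₂ W u ≤ PI / PT := by
  have := h.2.2
  rw [re_trace_mul_smul_outer, mul_comm] at this
  exact (le_div_iff₀ hPT).mpr this

/-! ### Both constraints active -/

theorem re_trace_covMu (hW : W.PosSemidef) (hμ : 0 ≤ μ) (hu : u ≠ 0) :
    (covMu W u PT μ).trace.re = PT := by
  rw [covMu_eq hW hμ, re_trace_smul_outer,
    div_mul_cancel₀ _ (norm_toLp_sq_pos (W2mu_inv_mulVec_ne_zero hW hμ hu)).ne']

theorem re_trace_mul_covMu (hW : W.PosSemidef) (hμ : 0 ≤ μ) :
    (W * covMu W u PT μ).trace.re = PT * (quad W ((W2mu W μ)⁻¹ *ᵥ u) /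
      ‖WithLp.toLp 2 ((W2mu W μ)⁻¹ *ᵥ u)‖ ^ 2) := by
  rw [covMu_eq hW hμ, re_trace_mul_smul_outer]
  ring

/-- Weak duality: the two constraints are added with multipliers $1$ and $\mu$. -/
theorem quad_le_of_mem_jointSet (hW : W.PosSemidef) (hμ : 0 ≤ μ)
    (hR : R ∈ jointSet W PT PI) :
    quad R u ≤ quad (W2mu W μ) ((W2mu W μ)⁻¹ *ᵥ u) * (W2mu W μ * R).trace.re ∧
      (W2mu W μ * R).trace.re ≤ PT + μ * PI := by
  refine ⟨quad_le_mul_trace (W2mu_posDef hW hμ).posSemidef hR.1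
    (W2mu_mulVec_inv_mulVec hW hμ u), ?_⟩
  rw [W2mu, Matrix.add_mul, Matrix.one_mul, Matrix.smul_mul, trace_add, trace_smul,
    Complex.add_re, Complex.smul_re, smul_eq_mul]
  exact add_le_add hR.2.1 (mul_le_mul_of_nonneg_left hR.2.2 hμ)

theorem quad_covMu (hW : W.PosSemidef) (hμ : 0 ≤ μ) :
    quad (covMu W u PT μ) u = PT / ‖WithLp.toLp 2 ((W2mu W μ)⁻¹ *ᵥ u)‖ ^ 2 *
      quad (W2mu W μ) ((W2mu W μ)⁻¹ *ᵥ u) ^ 2 := by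
  rw [covMu_eq hW hμ, quad_smul_outer_of_mulVec_eq (W2mu_posDef hW hμ).isHermitian _
    (W2mu_mulVec_inv_mulVec hW hμ u)]

theorem quad_covMu_of_trace_eq (hW : W.PosSemidef) (hμ : 0 ≤ μ) (hu : u ≠ 0)
    (h : (W * covMu W u PT μ).trace.re = PI) :
    quad (covMu W u PT μ) u = quad (W2mu W μ) ((W2mu W μ)⁻¹ *ᵥ u) * (PT + μ * PI) := by
  have hn := norm_toLp_sq_pos (W2mu_inv_mulVec_ne_zero hW hμ hu)
  rw [re_trace_mul_covMu hW hμ] at h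
  rw [quad_covMu hW hμ, ← h, quad_W2mu]
  generalize ‖WithLp.toLp 2 ((W2mu W μ)⁻¹ *ᵥ u)‖ ^ 2 = n at hn
  field_simp

theorem covMu_isOptimal (hlam : 0 < lam) (hW : W.PosSemidef) (hμ : 0 ≤ μ) (hu : u ≠ 0)
    (hPT : 0 < PT) (h : (W * covMu W u PT μ).trace.re = PI) :
    IsOptimal (lam • outer u) (jointSet W PT PI) (covMu W u PT μ) := by
  have hs := quad_nonneg (W2mu_posDef hW hμ).posSemidef ((W2mu W μ)⁻¹ *ᵥ u)
  refine (isOptimal_smul_outer_iff hlam fun R hR => hR.1).mpr ⟨⟨?_, ?_, h.le⟩, fun R hR => ?_⟩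
  · rw [covMu_eq hW hμ]
    exact smul_outer_posSemidef (by positivity) _
  · exact (re_trace_covMu hW hμ hu).le
  · obtain ⟨h1, h2⟩ := quad_le_of_mem_jointSet (u := u) hW hμ hR
    rw [quad_covMu_of_trace_eq hW hμ hu h]
    exact h1.trans (mul_le_mul_of_nonneg_left h2 hs)

theorem eq_covMu_of_isOptimal (hlam : 0 < lam) (hW : W.PosSemidef) (hμ : 0 ≤ μ) (hu : u ≠ 0)
    (hPT : 0 < PT) (h : (W * covMu W u PT μ).trace.re = PI)
    (hR : IsOptimal (lam • outer u) (jointSet W PT PI) R) : R = covMu W u PT μ := by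
  have huv := W2mu_mulVec_inv_mulVec hW hμ u
  have hs := quad_nonneg (W2mu_posDef hW hμ).posSemidef ((W2mu W μ)⁻¹ *ᵥ u)
  have hq := IsOptimal.quad_eq hlam (fun R hR => hR.1)
    (covMu_isOptimal hlam hW hμ hu hPT h) hR
  obtain ⟨h1, h2⟩ := quad_le_of_mem_jointSet (u := u) hW hμ hR.1
  rw [covMu_eq hW hμ]
  refine eq_smul_outer_of_quad_eq (W2mu_posDef hW hμ) hR.1.1 hu huv ?_ (h1.antisymm ?_)
  · rw [hq, quad_covMu hW hμ]
  · rw [hq, quad_covMu_of_trace_eq hW hμ hu h]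
    exact mul_le_mul_of_nonneg_left h2 hs

theorem rayleigh_of_mulVec_eq_smul (hx : x ≠ 0) {ν : ℂ} (h : W *ᵥ x = ν • x) :
    quad W x / ‖WithLp.toLp 2 x‖ ^ 2 = ν.re := by
  rw [div_eq_iff (norm_toLp_sq_pos hx).ne', quad, h, dotProduct_smul, smul_eq_mul,
    ← ofReal_norm_toLp_sq, Complex.re_mul_ofReal]

/-- Vectors whose rank-one matrices are positively proportional are proportional. -/
theorem exists_eq_smul_of_smul_outer_eq {y z : Fin m → ℂ} {s t : ℝ} (hs : s ≠ 0) (hy : y ≠ 0)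
    (h : s • outer y = t • outer z) : ∃ c : ℂ, y = c • z := by
  -- Applied to `y`, the identity reads $s(y^+y)y=t(z^+y)z$.
  have h1 := congrArg (· *ᵥ y) h
  simp only [smul_mulVec, outer, vecMulVec_mulVec, op_smul_eq_smul, ← Complex.coe_smul,
    smul_smul] at h1
  have h2 : (s * (star y ⬝ᵥ y) : ℂ) ≠ 0 := by
    rw [← ofReal_norm_toLp_sq]
    exact_mod_cast mul_ne_zero hs (norm_toLp_sq_pos hy).ne'
  refine ⟨(s * (star y ⬝ᵥ y) : ℂ)⁻¹ * (t * (star z ⬝ᵥ y)), ?_⟩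
  rw [mul_smul, ← h1, smul_smul, inv_mul_cancel₀ h2, one_smul]

theorem covMu_injective_of_trace_eq (hlam : 0 < lam) (hW : W.PosSemidef)
    (hu : ‖WithLp.toLp 2 u‖ = 1) (hPT : 0 < PT) (hγ : PI / PT < gamma₂ W u) {μ' : ℝ}
    (hμ : 0 < μ) (hμ' : 0 < μ') (h : (W * covMu W u PT μ).trace.re = PI)
    (h' : (W * covMu W u PT μ').trace.re = PI) : μ' = μ := by
  have hu0 := ne_zero_of_norm_toLp_eq_one hu
  have he := eq_covMu_of_isOptimal hlam hW hμ.le hu0 hPT h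
    (covMu_isOptimal hlam hW hμ'.le hu0 hPT h')
  rw [covMu_eq hW hμ.le, covMu_eq hW hμ'.le] at he
  have hy0 := W2mu_inv_mulVec_ne_zero hW hμ.le hu0
  have hz0 := W2mu_inv_mulVec_ne_zero hW hμ'.le hu0
  have hy := W2mu_mulVec_inv_mulVec hW hμ.le u
  have hz := W2mu_mulVec_inv_mulVec hW hμ'.le u
  rw [re_trace_mul_covMu hW hμ.le] at h
  set y := (W2mu W μ)⁻¹ *ᵥ u
  set z := (W2mu W μ')⁻¹ *ᵥ u
  have hzn := norm_toLp_sq_pos hz0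
  obtain ⟨c, hc⟩ := exists_eq_smul_of_smul_outer_eq (div_pos hPT hzn).ne' hz0 he
  rw [W2mu_mulVec] at hy hz
  -- With $z=cy$, compare $y+\mu Wy=u=c(y+\mu'Wy)$.
  have e : (1 - c) • y = (μ' * c - μ : ℂ) • (W *ᵥ y) := by
    rw [← hy, hc, mulVec_smul, ← Complex.coe_smul, ← Complex.coe_smul, smul_smul] at hz
    rw [sub_smul, sub_smul, one_smul, sub_eq_sub_iff_add_eq_add, ← hz]
    abel
  by_cases hd : (μ' * c - μ : ℂ) = 0
  · rw [hd, zero_smul, smul_eq_zero, or_iff_left hy0, sub_eq_zero] at e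
    rw [← e, mul_one, sub_eq_zero] at hd
    exact_mod_cast hd
  -- Now `y`, and with it $u=y+\mu Wy$, is an eigenvector of `W` for the same eigenvalue, so
  -- $P_I/P_T=\gamma_2$.
  · exfalso
    obtain ⟨ν, hν⟩ : ∃ ν : ℂ, W *ᵥ y = ν • y :=
      ⟨(μ' * c - μ : ℂ)⁻¹ * (1 - c), by rw [mul_smul, e, smul_smul, inv_mul_cancel₀ hd, one_smul]⟩
    have hWu : W *ᵥ u = ν • u := by
      rw [← hy, hν, mulVec_add, mulVec_smul, mulVec_smul, hν, smul_add, smul_comm ν μ]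
    rw [rayleigh_of_mulVec_eq_smul hy0 hν] at h
    have h2 := rayleigh_of_mulVec_eq_smul hu0 hWu
    rw [hu, one_pow, div_one] at h2
    rw [gamma₂, h2, ← h, mul_div_cancel_left₀ _ hPT.ne'] at hγ
    exact hγ.false

theorem existsUnique_trace_mul_covMu_eq (hlam : 0 < lam) (hW : W.PosSemidef)
    (hu : ‖WithLp.toLp 2 u‖ = 1) (hPT : 0 < PT) (hPI : 0 < PI)
    (h1 : W *ᵥ (pinv W *ᵥ u) = u → gamma₁ W u < PI / PT) (h2 : PI / PT < gamma₂ W u) :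
    ∃! μ : ℝ, 0 < μ ∧ (W * covMu W u PT μ).trace.re = PI := by
  obtain ⟨μ, hμ, he⟩ := exists_rayleigh_eq hW hu (div_pos hPI hPT) h1 h2
  have h : (W * covMu W u PT μ).trace.re = PI := by
    rw [re_trace_mul_covMu hW hμ.le, he, mul_div_cancel₀ _ hPT.ne']
  exact ⟨μ, ⟨hμ, h⟩, fun μ' hμ' => covMu_injective_of_trace_eq hlam hW hu hPT h2 hμ hμ'.1 h hμ'.2⟩

/-- The optimum need not be unique when `W` is singular, but its compression $PRP$ to the range of
`W` is forced and already has trace $P_T$. -/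
theorem both_active_of_gamma₁_eq (hlam : 0 < lam) (hW : W.PosSemidef) (hu : u ≠ 0)
    (hPT : 0 < PT) (hPI : 0 < PI) (hr : W *ᵥ (pinv W *ᵥ u) = u) (hγ : gamma₁ W u = PI / PT)
    (hR : IsOptimal (lam • outer u) (jointSet W PT PI) R) :
    R.trace.re = PT ∧ (W * R).trace.re = PI := by
  have hH := hW.isHermitian
  have hpH := pinv_isHermitian hH
  obtain ⟨hs, hn⟩ := quad_pinv_pos hW hu hr
  have hopt := isOptimal_covIPC hW hu hr hlam jointSet_subset_ipcSet
    (covIPC_mem_jointSet hW hu hr hPT hPI.le hγ.ge)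
  have hq := IsOptimal.quad_eq hlam (fun R hR => hR.1) hopt hR
  rw [quad_covIPC hW hu hr] at hq
  have htr := re_trace_mul_eq_of_quad_eq hW hu hr (jointSet_subset_ipcSet hR.1) hq
  refine ⟨hR.1.2.1.antisymm ?_, htr⟩
  set P := pinv W * W with hP
  have hPh : P.IsHermitian := (pinv_isMoorePenrose W).right_hermitian
  have hPP : P * P = P := by
    rw [hP, ← Matrix.mul_assoc, (pinv_isMoorePenrose W).self_mul_mul]
  have key := compress_eq_of_quad_eq hW hR.1.1 hr
    (by rw [quad_mulVec_eq hpH hr, hq, htr, mul_comm]) hPh hP.symm rfl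
  rw [quad_mulVec_eq hpH hr, hq] at key
  have h1 : (P * R).trace.re = PT := by
    have := congrArg (fun A => A.trace.re) key
    simp only [trace_smul, Complex.smul_re, trace_outer, smul_eq_mul] at this
    rw [trace_mul_comm (P * R), ← Matrix.mul_assoc, hPP] at this
    rw [gamma₁_eq hH, div_eq_div_iff hn.ne' hPT.ne'] at hγ
    refine mul_left_cancel₀ (pow_pos hs 2).ne' (this.trans ?_)
    linear_combination -quad (pinv W) u * hγ
  -- The part of `R` off the range of `W` can only add power, so $\mathrm{tr}\,R\ge P_T$.
  have h2 : 0 ≤ ((1 - P) * R).trace.re := by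
    refine re_trace_mul_nonneg ?_ hR.1.1
    have h3 : (1 - P) = (1 - P)ᴴ * (1 - P) := by
      rw [(isHermitian_one.sub hPh).eq, Matrix.mul_sub, Matrix.sub_mul, Matrix.sub_mul, hPP]
      simp
    rw [h3]
    exact posSemidef_conjTranspose_mul_self _
  rw [Matrix.sub_mul, Matrix.one_mul, trace_sub, Complex.sub_re, h1] at h2
  linarith

theorem both_active (hlam : 0 < lam) (hW : W.PosSemidef) (hu : ‖WithLp.toLp 2 u‖ = 1)
    (hPT : 0 < PT) (hPI : 0 < PI) (h1 : W *ᵥ (pinv W *ᵥ u) = u → gamma₁ W u ≤ PI / PT)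
    (h2 : PI / PT < gamma₂ W u) (hR : IsOptimal (lam • outer u) (jointSet W PT PI) R) :
    R.trace.re = PT ∧ (W * R).trace.re = PI := by
  have hu0 := ne_zero_of_norm_toLp_eq_one hu
  -- The multiplier is available only for strict inequality; the threshold $\gamma_I=\gamma_1$ is
  -- treated by compression.
  by_cases hb : W *ᵥ (pinv W *ᵥ u) = u ∧ gamma₁ W u = PI / PT
  · exact both_active_of_gamma₁_eq hlam hW hu0 hPT hPI hb.1 hb.2 hR
  · obtain ⟨μ, ⟨hμ, h⟩, -⟩ := existsUnique_trace_mul_covMu_eq hlam hW hu hPT hPI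
      (fun hr => (h1 hr).lt_of_ne fun he => hb ⟨hr, he⟩) h2
    rw [eq_covMu_of_isOptimal hlam hW hμ.le hu0 hPT h hR]
    exact ⟨re_trace_covMu hW hμ.le hu0, h⟩

theorem alphaMu_le_one (hW : W.PosSemidef) (hu : ‖WithLp.toLp 2 u‖ = 1) (hμ : 0 < μ) :
    alphaMu W u μ ≤ 1 ∧ (alphaMu W u μ = 1 ↔ IsEigenvector W u) := by
  have hu0 := ne_zero_of_norm_toLp_eq_one hu
  have hn := norm_toLp_sq_pos (W2mu_inv_mulVec_ne_zero hW hμ.le hu0)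
  have hH := (W2mu_posDef hW hμ.le).isHermitian.inv
  rw [alphaMu, ← div_eq_mul_inv, div_le_one hn, div_eq_one_iff_eq hn.ne',
    quad_sq_eq_iff hH hu (W2mu_mulVec_inv_mulVec hW hμ.le u) (W2mu_inv_mulVec_mulVec hW hμ.le u),
    isEigenvector_W2mu_iff hμ.ne' hu0]
  exact ⟨quad_sq_le hH hu, Iff.rfl⟩

theorem isCapacity_alphaMu (hlam : 0 < lam) (hW : W.PosSemidef) (hμ : 0 ≤ μ) (hu : u ≠ 0)
    (hPT : 0 < PT) (h : (W * covMu W u PT μ).trace.re = PI) :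
    IsCapacity (lam • outer u) (jointSet W PT PI) (Real.log (1 + lam * alphaMu W u μ * PT)) := by
  have hopt := covMu_isOptimal hlam hW hμ hu hPT h
  have := hopt.isCapacity
  rw [rate_smul_outer _ hopt.1.1.isHermitian, quad_covMu hW hμ,
    quad_mulVec_eq (W2mu_posDef hW hμ).isHermitian.inv (W2mu_mulVec_inv_mulVec hW hμ u)] at this
  convert this using 3
  rw [alphaMu]
  ring

end MIMO

theorem mainTheorem5 (m : ℕ) (W₁ W₂ : Matrix (Fin m) (Fin m) ℂ) (u₁ : Fin m → ℂ)
    (lam₁ PT PI : ℝ)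
    (hlam : 0 < lam₁) (hu : ‖WithLp.toLp 2 u₁‖ = 1) (hW₁ : W₁ = lam₁ • outer u₁)
    (hW₂ : W₂.PosSemidef) (hPT : 0 < PT) (hPI : 0 ≤ PI) :
    -- Regime 1: interference-limited
    (LinearMap.ker (Matrix.toLin' W₂) ≤ LinearMap.ker (Matrix.toLin' W₁) →
      PI / PT ≤ gamma₁ W₂ u₁ →
        TPCRedundant W₁ W₂ PT PI ∧
        IsOptimal W₁ (jointSet W₂ PT PI) (covIPC W₂ u₁ PI) ∧
        (W₂.PosDef →
          ∀ R, IsOptimal W₁ (jointSet W₂ PT PI) R → R = covIPC W₂ u₁ PI) ∧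
        IsCapacity W₁ (jointSet W₂ PT PI)
          (Real.log (1 + lam₁ * (PI / PT * quad (pinv W₂) u₁) * PT)) ∧
        (PI / PT < gamma₁ W₂ u₁ → PI / PT * quad (pinv W₂) u₁ < 1) ∧
        (PI / PT = gamma₁ W₂ u₁ → PI / PT * quad (pinv W₂) u₁ ≤ 1 ∧
          (PI / PT * quad (pinv W₂) u₁ = 1 ↔ IsEigenvector W₂ u₁))) ∧
    -- Regime 2: power-limited
    (gamma₂ W₂ u₁ ≤ PI / PT →
        IPCRedundant W₁ W₂ PT PI ∧
        IsOptimal W₁ (tpcSet PT) (PT • outer u₁) ∧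
        IsOptimal W₁ (jointSet W₂ PT PI) (PT • outer u₁) ∧
        (∀ R, IsOptimal W₁ (jointSet W₂ PT PI) R → R = PT • outer u₁) ∧
        IsCapacity W₁ (jointSet W₂ PT PI) (Real.log (1 + lam₁ * PT))) ∧
    (IsOptimal W₁ (jointSet W₂ PT PI) (PT • outer u₁) → gamma₂ W₂ u₁ ≤ PI / PT) ∧
    -- Regime 3: both constraints are active
    (0 < PI →
      (LinearMap.ker (Matrix.toLin' W₂) ≤ LinearMap.ker (Matrix.toLin' W₁) →
        gamma₁ W₂ u₁ ≤ PI / PT) →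
      PI / PT < gamma₂ W₂ u₁ →
        ∀ R, IsOptimal W₁ (jointSet W₂ PT PI) R → R.trace.re = PT ∧ (W₂ * R).trace.re = PI) ∧
    (0 < PI →
      (LinearMap.ker (Matrix.toLin' W₂) ≤ LinearMap.ker (Matrix.toLin' W₁) →
        gamma₁ W₂ u₁ < PI / PT) →
      PI / PT < gamma₂ W₂ u₁ →
        (∃! μ₂ : ℝ, 0 < μ₂ ∧ (W₂ * covMu W₂ u₁ PT μ₂).trace.re = PI) ∧
        (∀ μ₂ : ℝ, 0 < μ₂ → (W₂ * covMu W₂ u₁ PT μ₂).trace.re = PI →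
          IsOptimal W₁ (jointSet W₂ PT PI) (covMu W₂ u₁ PT μ₂) ∧
          (∀ R, IsOptimal W₁ (jointSet W₂ PT PI) R → R = covMu W₂ u₁ PT μ₂) ∧
          IsCapacity W₁ (jointSet W₂ PT PI) (Real.log (1 + lam₁ * alphaMu W₂ u₁ μ₂ * PT)) ∧
          alphaMu W₂ u₁ μ₂ ≤ 1 ∧
          (alphaMu W₂ u₁ μ₂ = 1 ↔ IsEigenvector W₂ u₁))) := by
  subst hW₁
  have hu0 := ne_zero_of_norm_toLp_eq_one hu
  -- Every null-space inclusion becomes $W_2W_2^\dagger u_1=u_1$, the form in which the lemmas take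
  -- it.
  simp only [ker_le_ker_smul_outer_iff hW₂.isHermitian hlam.ne' hu0]
  refine ⟨fun hr hγ => interference_limited hlam hu hW₂ hPT hPI hr hγ,
    fun hγ => power_limited hlam hu hPT hγ, fun h => gamma₂_le_of_mem_jointSet hPT h.1,
    fun hPI' h1 h2 R hR => both_active hlam hW₂ hu hPT hPI' h1 h2 hR,
    fun hPI' h1 h2 => ⟨existsUnique_trace_mul_covMu_eq hlam hW₂ hu hPT hPI' h1 h2,
      fun μ hμ h => ⟨covMu_isOptimal hlam hW₂ hμ.le hu0 hPT h,
        fun R hR => eq_covMu_of_isOptimal hlam hW₂ hμ.le hu0 hPT h hR,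
        isCapacity_alphaMu hlam hW₂ hμ.le hu0 hPT h, alphaMu_le_one hW₂ hu hμ⟩⟩⟩
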